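/- Let $\Omega=(a,b)$ be a bounded interval, $T>0$, $\alpha\in(0,1)$ and $\max\{0,\frac{\alpha}{2}-\frac{1-\alpha}{1+\alpha}\}\le\theta\le\frac{\alpha}{2}$. Let $\omega_k$ be the coefficients of $\omega(\xi)=(1-\xi)^{\alpha}\big[1+(\frac{\alpha}{2}-\theta)(1-\xi)\big]=\sum_{k\ge 0}\omega_k\xi^k$. Write $(\cdot,\cdot)$ and $\|\cdot\|$ for the inner product and norm of $L^2(\Omega)$. Then there is a constant $C>0$, depending only on $\alpha,\theta,T,\Omega$, such that the following holds. Let $N\ge1$, $\tau=T/N$, let $\mathcal{T}_h$ be a partition of $\Omega$ into finitely many intervals, let $r\ge1$, and let $X_h$ be the space of all $\chi\in H^1_0(\Omega)$ whose restriction to each $e\in\mathcal{T}_h$ is a polynomial of degree at most $r$. Let $u_0\in L^2(\Omega)$ have weak Laplacian $\Delta u_0\in L^2(\Omega)$, let $g$ be a source term with values $g(t)=g(\cdot,t)\in L^2(\Omega)$, and put $g^{j-\theta}:=g((j-\theta)\tau)$. Let $V^0=0$ and $V^1,\dots,V^N\in X_h$ solve the fully discrete scheme $$\tau^{-\alpha}\sum_{k=0}^{n}\omega_{n-k}(V^k,\chi_h)+(\nabla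 V^{n-\theta},\nabla\chi_h)=(g^{n-\theta}+\Delta u_0,\chi_h)\qquad\text{for all }\chi_h\in X_h,\ 1\le n\le N,$$ where $V^{n-\theta}:=(1-\theta)V^n+\theta V^{n-1}$. Let $u_{0h}\in L^2(\Omega)$ (an approximation of $u_0$) and $U^n:=V^n+u_{0h}$. Then for $1\le n\le N$ $$\|U^n\|\le\|u_{0h}\|+C\|\Delta u_0\|+C\max_{1\le j\le n}\|g^{j-\theta}\|.$$ In particular $C$ is independent of $\tau$ and of the mesh size $h$; no smallness of $\tau$ is needed. -/

import Mathlib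

open MeasureTheory Set
open scoped ContDiff

noncomputable section

/-- The real Hilbert space `L²(Ω)` of the bounded interval `Ω = (a, b)`. -/
abbrev L2 (a b : ℝ) : Type := Lp ℝ 2 (volume.restrict (Ioo a b))

/-- Test functions `φ ∈ C_c^∞(a, b)`. -/
def IsTestFunction (a b : ℝ) (φ : ℝ → ℝ) : Prop :=
  ContDiff ℝ ∞ φ ∧ HasCompactSupport φ ∧ tsupport φ ⊆ Ioo a b

/-- `w ∈ L²(Ω)` is the weak (distributional) Laplacian `Δu` of `u ∈ L²(Ω)`, in one dimension:
`∫ u φ'' = ∫ w φ` for all test functions `φ`. -/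
def IsWeakLaplacian (a b : ℝ) (u w : L2 a b) : Prop :=
  ∀ φ : ℝ → ℝ, IsTestFunction a b φ →
    ∫ x in Ioo a b, u x * deriv (deriv φ) x = ∫ x in Ioo a b, w x * φ x

/-- The pairs `(φ, φ')` in `L²(Ω) × L²(Ω)` with `φ` a test function. -/
def testGraph (a b : ℝ) : Submodule ℝ (L2 a b × L2 a b) where
  carrier := {p | ∃ φ : ℝ → ℝ, IsTestFunction a b φ ∧
    p.1 =ᵐ[volume.restrict (Ioo a b)] φ ∧ p.2 =ᵐ[volume.restrict (Ioo a b)] deriv φ}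
  zero_mem' := by
    refine ⟨0, ⟨contDiff_const, HasCompactSupport.zero, by simp⟩, Lp.coeFn_zero _ _ _, ?_⟩
    have h : deriv (0 : ℝ → ℝ) = 0 := by ext x; simp
    rw [h]
    exact Lp.coeFn_zero _ _ _
  add_mem' := by
    rintro p q ⟨φ, ⟨hφ, hφc, hφs⟩, h1, h2⟩ ⟨ψ, ⟨hψ, hψc, hψs⟩, h3, h4⟩
    refine ⟨φ + ψ, ⟨hφ.add hψ, hφc.add hψc,
      (tsupport_add φ ψ).trans (union_subset hφs hψs)⟩,
      (Lp.coeFn_add _ _).trans (h1.add h3), (Lp.coeFn_add _ _).trans ?_⟩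
    have h : deriv (φ + ψ) = deriv φ + deriv ψ := by
      ext x
      exact deriv_add (hφ.differentiable (by simp) x) (hψ.differentiable (by simp) x)
    rw [h]
    exact h2.add h4
  smul_mem' := by
    rintro c p ⟨φ, ⟨hφ, hφc, hφs⟩, h1, h2⟩
    refine ⟨c • φ, ⟨hφ.const_smul c, hφc.smul_left (f := fun _ => c),
      (tsupport_smul_subset_right (fun _ => c) φ).trans hφs⟩,
      (Lp.coeFn_smul _ _).trans (h1.const_smul c), (Lp.coeFn_smul _ _).trans ?_⟩
    have h : deriv (c • φ) = c • deriv φ := by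
      ext x
      exact deriv_const_smul c (hφ.differentiable (by simp) x)
    rw [h]
    exact h2.const_smul c

/-- The Sobolev space `H¹₀(Ω)`, the closure of `C_c^∞(Ω)` in the `H¹` norm. A function
`v ∈ H¹₀(Ω)` is represented by the pair `(v, ∇v)` of the function and its weak derivative, so
that convergence in `H¹` is convergence in `L²(Ω) × L²(Ω)`. -/
def H10 (a b : ℝ) : Submodule ℝ (L2 a b × L2 a b) := (testGraph a b).topologicalClosure

/-- A partition `a = x₀ < x₁ < ⋯ < x_M = b` of the interval `Ω = (a, b)`; its elements are the
intervals `(xᵢ, xᵢ₊₁)`. -/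
structure Mesh (a b : ℝ) where
  M : ℕ
  node : Fin (M + 1) → ℝ
  strictMono : StrictMono node
  node_zero : node 0 = a
  node_last : node (Fin.last M) = b

/-- The finite element space `X_h` of all `v ∈ H¹₀(Ω)` (represented by `(v, ∇v)`) whose
restriction to every element of the mesh is a polynomial of degree at most `r`. -/
def femSpace {a b : ℝ} (𝒯 : Mesh a b) (r : ℕ) : Submodule ℝ (L2 a b × L2 a b) where
  carrier := {p | p ∈ H10 a b ∧ ∀ i : Fin 𝒯.M, ∃ P : Polynomial ℝ, P.natDegree ≤ r ∧
    ∀ᵐ x ∂(volume.restrict (Ioo a b)),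
      x ∈ Ioo (𝒯.node i.castSucc) (𝒯.node i.succ) → p.1 x = P.eval x}
  zero_mem' := by
    refine ⟨zero_mem _, fun i => ⟨0, by simp, ?_⟩⟩
    filter_upwards [Lp.coeFn_zero ℝ 2 (volume.restrict (Ioo a b))] with x hx _
    simpa using hx
  add_mem' := by
    rintro p q ⟨hp, hp'⟩ ⟨hq, hq'⟩
    refine ⟨add_mem hp hq, fun i => ?_⟩
    obtain ⟨P, hP, h1⟩ := hp' i
    obtain ⟨Q, hQ, h2⟩ := hq' i
    refine ⟨P + Q, (Polynomial.natDegree_add_le _ _).trans (max_le hP hQ), ?_⟩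
    filter_upwards [h1, h2, Lp.coeFn_add p.1 q.1] with x h1 h2 h3 hx
    rw [Polynomial.eval_add, ← h1 hx, ← h2 hx]
    exact h3
  smul_mem' := by
    rintro c p ⟨hp, hp'⟩
    refine ⟨Submodule.smul_mem _ c hp, fun i => ?_⟩
    obtain ⟨P, hP, h1⟩ := hp' i
    refine ⟨c • P, (Polynomial.natDegree_smul_le _ _).trans hP, ?_⟩
    filter_upwards [h1, Lp.coeFn_smul c p.1] with x h1 h3 hx
    rw [Polynomial.eval_smul, ← h1 hx]
    exact h3

/-- The generating power series
`ω(ξ) = (1 - ξ)^α * (1 + (α/2 - θ) (1 - ξ))` of the convolution weights, where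
`(1 - ξ)^α` is the binomial series `∑ₙ (α choose n) (-ξ)ⁿ`. -/
def weightSeries (α θ : ℝ) : PowerSeries ℝ :=
  PowerSeries.rescale (-1 : ℝ) (PowerSeries.binomialSeries ℝ α) *
    (1 + PowerSeries.C (α / 2 - θ) * (1 - PowerSeries.X))

/-- The convolution weight `ω_k`. -/
def weight (α θ : ℝ) (k : ℕ) : ℝ := PowerSeries.coeff k (weightSeries α θ)

/-- `V⁰ = 0, V¹, …, V^N ∈ X_h` solve the fully discrete scheme with step size `τ`, source term
`g : t ↦ g(t) ∈ L²(Ω)` and initial Laplacian `lapU0 = Δu₀`: for `1 ≤ n ≤ N` and all `χ ∈ X_h`,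
`τ^(-α) ∑_{k=0}^n ω_{n-k} (V^k, χ) + (∇V^{n-θ}, ∇χ) = (g^{n-θ} + Δu₀, χ)`, where
`V^{n-θ} = (1 - θ) V^n + θ V^{n-1}` and `g^{n-θ} = g((n - θ) τ)`.
Here `(V n).1` is the function `V^n` and `(V n).2` its weak derivative. -/
def IsDiscreteSolution {a b : ℝ} (α θ τ : ℝ) (N : ℕ) (𝒯 : Mesh a b) (r : ℕ)
    (g : ℝ → L2 a b) (lapU0 : L2 a b) (V : ℕ → L2 a b × L2 a b) : Prop :=
  V 0 = 0 ∧ (∀ n ≤ N, V n ∈ femSpace 𝒯 r) ∧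
  ∀ n, 1 ≤ n → n ≤ N → ∀ χ ∈ femSpace 𝒯 r,
    τ ^ (-α) * ∑ k ∈ Finset.range (n + 1), weight α θ (n - k) * inner ℝ (V k).1 χ.1
      + inner ℝ ((1 - θ) • (V n).2 + θ • (V (n - 1)).2) χ.2
    = inner ℝ (g (((n : ℝ) - θ) * τ) + lapU0) χ.1

end

/-! Write `d = α/2 - θ`. The bounds on `θ` make every weight after `ω_0` nonpositive
(`weight_nonpos`), while the partial sums still dominate `c (k+1)^(-α)` with `c > 0`
(`le_sum_weight`). Testing the scheme with `V^{n-θ}`, a polarization argument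
(`sum_mul_norm_sq_le_two_mul_sum_inner`) and the Poincaré inequality give `∑ ω_{n-k} ‖V^k‖² ≤ C τ^α
‖f‖²`, where `f` is the right-hand side at step `n`. At an index `n` where `‖V^n‖` is maximal, the
left side is at least `c n^(-α) ‖V^n‖²`. Since `n τ ≤ T`, the step size disappears; a maximum
principle replaces a discrete Gronwall inequality, so `τ` need not be small. -/

/-! ### Signs and partial sums of the convolution weights -/

/-- Partial sums of the coefficients of `(1 - ξ)^α`, that is, the coefficients of
`(1 - ξ)^(α - 1)`. -/
noncomputable def binomPartialSum (α : ℝ) (k : ℕ) : ℝ := ∏ j ∈ Finset.range k, (1 - α / (j + 1))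

lemma binomPartialSum_succ (α : ℝ) (k : ℕ) :
    binomPartialSum α (k + 1) = binomPartialSum α k * (1 - α / (k + 1)) :=
  Finset.prod_range_succ _ _

lemma choose_real_succ (α : ℝ) (k : ℕ) :
    (k + 1) * Ring.choose α (k + 1) = Ring.choose α k * (α - k) := by
  have h := Ring.choose_smul_choose α (Nat.le_succ k)
  simpa using h

lemma coeff_rescale_binomialSeries_succ (α : ℝ) (k : ℕ) :
    PowerSeries.coeff (k + 1) (PowerSeries.rescale (-1 : ℝ) (PowerSeries.binomialSeries ℝ α))
      = -(α / (k + 1)) * binomPartialSum α k := by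
  induction k with
  | zero => simp [PowerSeries.coeff_rescale, binomPartialSum]
  | succ k ih =>
    have h := choose_real_succ α (k + 1)
    simp only [PowerSeries.coeff_rescale, PowerSeries.binomialSeries_coeff, smul_eq_mul,
      mul_one] at ih ⊢
    rw [binomPartialSum_succ]
    have hk : (k : ℝ) + 1 ≠ 0 := by positivity
    have hk' : (k : ℝ) + 1 + 1 ≠ 0 := by positivity
    push_cast at h ⊢
    have e : Ring.choose α (k + 1 + 1) = Ring.choose α (k + 1) * (α - (k + 1)) / (k + 1 + 1) := by
      rw [eq_div_iff hk', ← h]; ring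
    have e2 : -(α / ((k : ℝ) + 1 + 1)) * (binomPartialSum α k * (1 - α / (k + 1)))
        = (-(α / (k + 1)) * binomPartialSum α k) * (k + 1 - α) / (k + 1 + 1) := by
      field_simp
    rw [e2, ← ih, e]
    ring

lemma weight_zero (α θ : ℝ) : weight α θ 0 = 1 + (α / 2 - θ) := by
  have h : PowerSeries.constantCoeff
      (PowerSeries.rescale (-1 : ℝ) (PowerSeries.binomialSeries ℝ α)) = 1 := by
    rw [← PowerSeries.coeff_zero_eq_constantCoeff_apply, PowerSeries.coeff_rescale]
    simp
  simp [weight, weightSeries, h]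

lemma weight_succ (α θ : ℝ) (k : ℕ) :
    weight α θ (k + 1) = (1 + (α / 2 - θ)) *
        PowerSeries.coeff (k + 1)
          (PowerSeries.rescale (-1 : ℝ) (PowerSeries.binomialSeries ℝ α))
      - (α / 2 - θ) * PowerSeries.coeff k
          (PowerSeries.rescale (-1 : ℝ) (PowerSeries.binomialSeries ℝ α)) := by
  have e : weightSeries α θ =
      PowerSeries.C (1 + (α / 2 - θ)) *
        PowerSeries.rescale (-1 : ℝ) (PowerSeries.binomialSeries ℝ α)
      - PowerSeries.C (α / 2 - θ) *
        (PowerSeries.rescale (-1 : ℝ) (PowerSeries.binomialSeries ℝ α) * PowerSeries.X) := by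
    rw [weightSeries, map_add, map_one]
    ring
  rw [weight, e, map_sub, PowerSeries.coeff_C_mul, PowerSeries.coeff_C_mul,
    PowerSeries.coeff_succ_mul_X]

lemma weight_one (α θ : ℝ) :
    weight α θ 1 = -((1 + (α / 2 - θ)) * α + (α / 2 - θ)) := by
  rw [weight_succ, coeff_rescale_binomialSeries_succ]
  simp [binomPartialSum]
  ring

/-- The last factor increases with `k`; at `k = 0` it is nonnegative exactly when `d ≤ (1-α)/(1+α)`,
which is the lower bound on `θ`. -/
lemma weight_succ_succ (α θ : ℝ) (k : ℕ) :
    weight α θ (k + 2) = -(α / ((k + 1) * (k + 2))) * binomPartialSum α k *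
      (k + 1 - α - (α / 2 - θ) * (1 + α)) := by
  rw [weight_succ, coeff_rescale_binomialSeries_succ, coeff_rescale_binomialSeries_succ,
    binomPartialSum_succ]
  have hk : (k : ℝ) + 1 ≠ 0 := by positivity
  have hk' : (k : ℝ) + 2 ≠ 0 := by positivity
  have hk'' : (k : ℝ) + 1 + 1 ≠ 0 := by positivity
  push_cast
  field_simp
  ring

/-- These are the coefficients of `ω(ξ)/(1-ξ) = (1-ξ)^(α-1) (1 + d(1-ξ))`. -/
lemma sum_weight (α θ : ℝ) (k : ℕ) :
    ∑ j ∈ Finset.range (k + 2), weight α θ j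
      = binomPartialSum α k * (1 - (1 + (α / 2 - θ)) * α / (k + 1)) := by
  induction k with
  | zero =>
    rw [Finset.sum_range_succ, Finset.sum_range_one, weight_zero, weight_one]
    simp [binomPartialSum]
    ring
  | succ k ih =>
    rw [Finset.sum_range_succ, ih, weight_succ_succ, binomPartialSum_succ]
    have hk : (k : ℝ) + 1 ≠ 0 := by positivity
    have hk' : (k : ℝ) + 2 ≠ 0 := by positivity
    have hk'' : (k : ℝ) + 1 + 1 ≠ 0 := by positivity
    push_cast
    field_simp
    ring

lemma one_sub_div_succ_nonneg {α : ℝ} (hα0 : 0 ≤ α) (hα1 : α ≤ 1) (k : ℕ) :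
    0 ≤ 1 - α / (k + 1) ∧ 1 - α / (k + 1) ≤ 1 := by
  have hk : (0 : ℝ) ≤ k := k.cast_nonneg
  have h1 : α / (k + 1) ≤ 1 := by rw [div_le_one (by positivity)]; linarith
  have h2 : 0 ≤ α / (k + 1) := by positivity
  constructor <;> linarith

lemma binomPartialSum_nonneg {α : ℝ} (hα0 : 0 ≤ α) (hα1 : α ≤ 1) (k : ℕ) :
    0 ≤ binomPartialSum α k :=
  Finset.prod_nonneg fun j _ => (one_sub_div_succ_nonneg hα0 hα1 j).1

lemma binomPartialSum_succ_le {α : ℝ} (hα0 : 0 ≤ α) (hα1 : α ≤ 1) (k : ℕ) :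
    binomPartialSum α (k + 1) ≤ binomPartialSum α k := by
  rw [binomPartialSum_succ]
  exact mul_le_of_le_one_right (binomPartialSum_nonneg hα0 hα1 k)
    (one_sub_div_succ_nonneg hα0 hα1 k).2

lemma le_binomPartialSum_succ {α : ℝ} (hα0 : 0 ≤ α) (hα1 : α ≤ 1) (k : ℕ) :
    (1 - α) * ((k : ℝ) + 1) ^ (-α) ≤ binomPartialSum α (k + 1) := by
  induction k with
  | zero => simp [binomPartialSum]
  | succ k ih =>
    rw [binomPartialSum_succ]
    have hk1 : (0 : ℝ) < (k : ℝ) + 1 := by positivity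
    have hk2 : (0 : ℝ) < (k : ℝ) + 2 := by positivity
    -- Bernoulli's inequality for the exponent `α ≤ 1`; the left sides telescope to `(k+1)^(-α)`,
    -- and `1 - α` is the first factor of the product.
    have hB : (((k : ℝ) + 1) / (k + 2)) ^ α ≤ 1 - α / (k + 2) := by
      have h := rpow_one_add_le_one_add_mul_self (s := -(1 / ((k : ℝ) + 2)))
        (by rw [neg_le_neg_iff, div_le_one hk2]; linarith) hα0 hα1
      have e : 1 + -(1 / ((k : ℝ) + 2)) = ((k : ℝ) + 1) / (k + 2) := by field_simp; ring
      rw [e] at h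
      calc _ ≤ _ := h
        _ = _ := by ring
    have e : (1 - α) * ((k : ℝ) + 2) ^ (-α)
        = ((1 - α) * ((k : ℝ) + 1) ^ (-α)) * (((k : ℝ) + 1) / (k + 2)) ^ α := by
      rw [Real.div_rpow hk1.le hk2.le, Real.rpow_neg hk1.le, Real.rpow_neg hk2.le]
      have := (Real.rpow_pos_of_pos hk1 α).ne'
      field_simp
    push_cast
    rw [show (k : ℝ) + 1 + 1 = k + 2 by ring, e]
    exact mul_le_mul ih hB (by positivity) (binomPartialSum_nonneg hα0 hα1 _)

lemma weight_nonpos {α θ : ℝ} (hα0 : 0 < α) (hα1 : α < 1) (hθ : θ ≤ α / 2)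
    (hc : (1 + (α / 2 - θ)) * (1 + α) ≤ 2) {k : ℕ} (hk : 1 ≤ k) : weight α θ k ≤ 0 := by
  obtain _ | _ | k := k
  · omega
  · rw [zero_add, weight_one]
    have : 0 ≤ α / 2 - θ := by linarith
    have : 0 ≤ (1 + (α / 2 - θ)) * α + (α / 2 - θ) := by positivity
    linarith
  · rw [weight_succ_succ]
    have h1 : 0 ≤ (k : ℝ) + 1 - α - (α / 2 - θ) * (1 + α) := by
      have : (0 : ℝ) ≤ k := k.cast_nonneg
      linarith
    have h2 := binomPartialSum_nonneg hα0.le hα1.le k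
    have : 0 ≤ α / (((k : ℝ) + 1) * (k + 2)) * binomPartialSum α k *
      (k + 1 - α - (α / 2 - θ) * (1 + α)) := by positivity
    linarith

lemma le_sum_weight {α θ : ℝ} (hα0 : 0 < α) (hα1 : α < 1) (hθ : θ ≤ α / 2)
    (hc : (1 + (α / 2 - θ)) * (1 + α) ≤ 2) (k : ℕ) :
    (1 - α) * (1 - (1 + (α / 2 - θ)) * α) * ((k : ℝ) + 1) ^ (-α)
      ≤ ∑ j ∈ Finset.range (k + 1), weight α θ j := by
  have hd : 0 ≤ α / 2 - θ := by linarith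
  have hα : 0 ≤ (1 + (α / 2 - θ)) * α := by positivity
  have h1 : 0 ≤ 1 - (1 + (α / 2 - θ)) * α := by nlinarith
  have h0 : 0 ≤ 1 - α := by linarith
  obtain _ | k := k
  · simp only [Nat.cast_zero, zero_add, Real.one_rpow, mul_one, Finset.sum_range_one, weight_zero]
    nlinarith
  · rw [sum_weight]
    have hk : (0 : ℝ) ≤ k := k.cast_nonneg
    have h2 : (1 + (α / 2 - θ)) * α / ((k : ℝ) + 1) ≤ (1 + (α / 2 - θ)) * α :=
      div_le_self hα (by linarith)
    have h3 : ((k + 1 : ℕ) + 1 : ℝ) ^ (-α) ≤ ((k : ℝ) + 1) ^ (-α) :=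
      Real.rpow_le_rpow_of_nonpos (by positivity) (by push_cast; linarith) (by linarith)
    have h4 : (1 - α) * ((k + 1 : ℕ) + 1 : ℝ) ^ (-α) ≤ binomPartialSum α k :=
      (mul_le_mul_of_nonneg_left h3 h0).trans
        ((le_binomPartialSum_succ hα0.le hα1.le k).trans (binomPartialSum_succ_le hα0.le hα1.le k))
    calc (1 - α) * (1 - (1 + (α / 2 - θ)) * α) * ((k + 1 : ℕ) + 1 : ℝ) ^ (-α)
        = ((1 - α) * ((k + 1 : ℕ) + 1 : ℝ) ^ (-α)) * (1 - (1 + (α / 2 - θ)) * α) := by ring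
      _ ≤ _ := mul_le_mul h4 (by linarith) h1 (binomPartialSum_nonneg hα0.le hα1.le k)

/-- Lets `ω_1` absorb the only positive weight `ω_0` in the energy estimate. The difference of the
two sides is `(1-θ)d + (1+d)(α(1-θ)-θ)`, nonnegative as `θ ≤ α/2` and `α < 1`. -/
lemma mul_weight_zero_le {α θ : ℝ} (hα0 : 0 < α) (hα1 : α < 1) (hθ : θ ≤ α / 2) :
    θ * weight α θ 0 ≤ (1 - θ) * -weight α θ 1 := by
  rw [weight_zero, weight_one, neg_neg]
  have hd : 0 ≤ α / 2 - θ := by linarith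
  have h1 : 0 ≤ (1 - θ) * (α / 2 - θ) := mul_nonneg (by linarith) hd
  have h2 : 0 ≤ (1 + (α / 2 - θ)) * (α * (1 - θ) - θ) :=
    mul_nonneg (by linarith) (by nlinarith)
  linarith

/-! ### Energy and maximum inequalities for discrete convolutions -/

/-- A discrete convolution whose weights are nonpositive apart from the first one, tested with
`(1 - θ) v_{m+1} + θ v_m`, dominates half of the same convolution of the squared norms. -/
lemma sum_mul_norm_sq_le_two_mul_sum_inner {E : Type*} [NormedAddCommGroup E]
    [InnerProductSpace ℝ E] {w : ℕ → ℝ} {θ : ℝ} (hw : ∀ k, 1 ≤ k → w k ≤ 0) (hθ0 : 0 ≤ θ)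
    (hθ1 : θ ≤ 1) (h01 : θ * w 0 ≤ (1 - θ) * -w 1) (v : ℕ → E) (m : ℕ)
    (hsum : 0 ≤ ∑ k ∈ Finset.range (m + 2), w k) :
    ∑ k ∈ Finset.range (m + 2), w (m + 1 - k) * ‖v k‖ ^ 2
      ≤ 2 * ∑ k ∈ Finset.range (m + 2),
        w (m + 1 - k) * inner ℝ (v k) ((1 - θ) • v (m + 1) + θ • v m) := by
  set p := v (m + 1)
  set q := v m
  -- Polarization: `2⟨v, p⟩ = ‖v‖² + ‖p‖² - ‖v - p‖²`, averaged over `p` and `q`.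
  have hterm : ∀ k, 2 * (w (m + 1 - k) * inner ℝ (v k) ((1 - θ) • p + θ • q))
      = w (m + 1 - k) * ‖v k‖ ^ 2
        + (w (m + 1 - k) * ((1 - θ) * ‖p‖ ^ 2 + θ * ‖q‖ ^ 2)
        - w (m + 1 - k) * ((1 - θ) * ‖v k - p‖ ^ 2 + θ * ‖v k - q‖ ^ 2)) := by
    intro k
    rw [norm_sub_sq_real, norm_sub_sq_real, inner_add_right, inner_smul_right, inner_smul_right]
    ring
  rw [Finset.mul_sum, Finset.sum_congr rfl fun k _ => hterm k, Finset.sum_add_distrib,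
    Finset.sum_sub_distrib, ← Finset.sum_mul]
  have hrefl : ∑ k ∈ Finset.range (m + 2), w (m + 1 - k) = ∑ k ∈ Finset.range (m + 2), w k :=
    Finset.sum_range_reflect w (m + 2)
  have hpos : 0 ≤ (∑ k ∈ Finset.range (m + 2), w k) * ((1 - θ) * ‖p‖ ^ 2 + θ * ‖q‖ ^ 2) := by
    have : 0 ≤ 1 - θ := by linarith
    positivity
  have hneg : ∑ k ∈ Finset.range (m + 2),
      w (m + 1 - k) * ((1 - θ) * ‖v k - p‖ ^ 2 + θ * ‖v k - q‖ ^ 2) ≤ 0 := by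
    rw [Finset.sum_range_succ, Finset.sum_range_succ]
    have h1 : ∑ k ∈ Finset.range m,
        w (m + 1 - k) * ((1 - θ) * ‖v k - p‖ ^ 2 + θ * ‖v k - q‖ ^ 2) ≤ 0 := by
      refine Finset.sum_nonpos fun k hk => mul_nonpos_of_nonpos_of_nonneg (hw _ ?_) ?_
      · have := Finset.mem_range.mp hk
        omega
      · have : 0 ≤ 1 - θ := by linarith
        positivity
    -- In the last two terms one of the two distances vanishes, so `w 0` and `w 1` multiply the same
    -- `‖p - q‖²`.
    have h2 : w (m + 1 - m) * ((1 - θ) * ‖v m - p‖ ^ 2 + θ * ‖v m - q‖ ^ 2)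
        + w (m + 1 - (m + 1)) * ((1 - θ) * ‖v (m + 1) - p‖ ^ 2 + θ * ‖v (m + 1) - q‖ ^ 2)
        = (θ * w 0 - (1 - θ) * -w 1) * ‖p - q‖ ^ 2 := by
      simp only [show v m = q from rfl, show v (m + 1) = p from rfl, sub_self, norm_zero,
        norm_sub_rev q p, add_tsub_cancel_left, Nat.sub_self]
      ring
    have h3 : (θ * w 0 - (1 - θ) * -w 1) * ‖p - q‖ ^ 2 ≤ 0 :=
      mul_nonpos_of_nonpos_of_nonneg (by linarith) (by positivity)
    linarith
  rw [hrefl]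
  linarith

/-- If the weights are nonpositive apart from the first one, a discrete convolution of a sequence
starting from `0` is, where the sequence is maximal, at least that maximum times the partial sum
of the weights. -/
lemma mul_sum_le_sum_mul_of_forall_le {w y : ℕ → ℝ} (hw : ∀ k, 1 ≤ k → w k ≤ 0) (hy0 : y 0 = 0)
    (m : ℕ) (hy : ∀ k ≤ m + 1, y k ≤ y (m + 1)) :
    y (m + 1) * ∑ k ∈ Finset.range (m + 1), w k
      ≤ ∑ k ∈ Finset.range (m + 2), w (m + 1 - k) * y k := by
  -- Since `y 0 = 0`, the weight `w (m + 1)` drops out.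
  rw [Finset.sum_range_succ' _ (m + 1), hy0, mul_zero, add_zero, ← Finset.sum_range_reflect w (m + 1),
    Finset.mul_sum]
  refine Finset.sum_le_sum fun k hk => ?_
  have hk' : k ≤ m := Nat.lt_succ_iff.mp (Finset.mem_range.mp hk)
  rw [show m + 1 - 1 - k = m - k by omega, show m + 1 - (k + 1) = m - k by omega, mul_comm]
  rcases hk'.eq_or_lt with rfl | h
  · rfl
  · exact mul_le_mul_of_nonpos_left (hy _ (by omega)) (hw _ (by omega))

/-! ### Poincaré inequality -/

/-- The Poincaré inequality for test functions. -/
lemma integral_sq_le_of_isTestFunction {a b : ℝ} (hab : a < b) {φ : ℝ → ℝ}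
    (hφ : IsTestFunction a b φ) :
    ∫ x in Ioo a b, φ x ^ 2 ≤ (2 * (b - a)) ^ 2 * ∫ x in Ioo a b, deriv φ x ^ 2 := by
  obtain ⟨hs, -, ht⟩ := hφ
  have hd : Differentiable ℝ φ := hs.differentiable (by simp)
  have hc' : Continuous (deriv φ) := hs.continuous_deriv (by simp)
  have hc : Continuous φ := hs.continuous
  have hφa : φ a = 0 := image_eq_zero_of_notMem_tsupport fun h => (ht h).1.false
  have hφb : φ b = 0 := image_eq_zero_of_notMem_tsupport fun h => (ht h).2.false
  -- The integrand is the derivative of `(x - a) φ²`, which vanishes at both ends.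
  have hzero : ∫ x in a..b, (φ x ^ 2 + (x - a) * (2 * φ x * deriv φ x)) = 0 := by
    rw [intervalIntegral.integral_eq_sub_of_hasDerivAt (f := fun x => (x - a) * φ x ^ 2)]
    · simp [hφa, hφb]
    · intro x _
      have h := ((hasDerivAt_id x).sub_const a).mul ((hd x).hasDerivAt.pow 2)
      refine h.congr_deriv ?_
      simp
    · exact Continuous.intervalIntegrable (by fun_prop) _ _
  have hmono : ∫ x in a..b, φ x ^ 2 ≤ ∫ x in a..b,
      (2 * (φ x ^ 2 + (x - a) * (2 * φ x * deriv φ x))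
        + (2 * (b - a)) ^ 2 * deriv φ x ^ 2) := by
    refine intervalIntegral.integral_mono_on hab.le
      (Continuous.intervalIntegrable (by fun_prop) _ _)
      (Continuous.intervalIntegrable (by fun_prop) _ _) fun x hx => ?_
    have h1 : (x - a) ^ 2 ≤ (b - a) ^ 2 := by
      have := hx.1
      have := hx.2
      gcongr
    -- Completing the square in `φ² + 4(x-a)φφ' + 4(x-a)²φ'²`.
    nlinarith [sq_nonneg (φ x + 2 * (x - a) * deriv φ x),
      mul_le_mul_of_nonneg_right h1 (sq_nonneg (deriv φ x))]
  rw [intervalIntegral.integral_add (Continuous.intervalIntegrable (by fun_prop) _ _)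
    (Continuous.intervalIntegrable (by fun_prop) _ _), intervalIntegral.integral_const_mul, hzero,
    intervalIntegral.integral_const_mul, mul_zero, zero_add] at hmono
  simpa only [intervalIntegral.integral_of_le hab.le, integral_Ioc_eq_integral_Ioo] using hmono

lemma norm_sq_eq_integral_of_ae_eq {a b : ℝ} {u : L2 a b} {φ : ℝ → ℝ}
    (h : u =ᵐ[volume.restrict (Ioo a b)] φ) : ‖u‖ ^ 2 = ∫ x in Ioo a b, φ x ^ 2 := by
  rw [← real_inner_self_eq_norm_sq, L2.inner_def]
  refine integral_congr_ae ?_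
  filter_upwards [h] with x hx
  simp [hx, sq]

/-- The Poincaré inequality in `H¹₀(a, b)`. -/
lemma norm_fst_le_of_mem_H10 {a b : ℝ} (hab : a < b) {p : L2 a b × L2 a b} (hp : p ∈ H10 a b) :
    ‖p.1‖ ≤ 2 * (b - a) * ‖p.2‖ := by
  have hclosed : IsClosed {q : L2 a b × L2 a b | ‖q.1‖ ≤ 2 * (b - a) * ‖q.2‖} :=
    isClosed_le (by fun_prop) (by fun_prop)
  have hL : 0 ≤ 2 * (b - a) := by linarith
  refine closure_minimal (fun q hq => ?_) hclosed
    (show p ∈ closure (testGraph a b : Set (L2 a b × L2 a b)) from hp)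
  obtain ⟨φ, hφ, h1, h2⟩ := hq
  refine (sq_le_sq₀ (norm_nonneg _) (by positivity)).mp ?_
  rw [mul_pow, norm_sq_eq_integral_of_ae_eq h1, norm_sq_eq_integral_of_ae_eq h2]
  exact integral_sq_le_of_isTestFunction hab hφ

/-! ### Stability of the scheme -/

lemma IsDiscreteSolution.sum_weight_mul_norm_sq_le {a b α θ τ : ℝ} {N : ℕ} {𝒯 : Mesh a b} {r : ℕ}
    {g : ℝ → L2 a b} {lapU0 : L2 a b} {V : ℕ → L2 a b × L2 a b}
    (hV : IsDiscreteSolution α θ τ N 𝒯 r g lapU0 V) (hα0 : 0 < α) (hα1 : α < 1)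
    (hc : (1 + (α / 2 - θ)) * (1 + α) ≤ 2) (hθ0 : 0 ≤ θ) (hθ1 : θ ≤ α / 2) (hab : a < b)
    (hτ : 0 < τ) {m : ℕ} (hm : m + 1 ≤ N) :
    ∑ k ∈ Finset.range (m + 2), weight α θ (m + 1 - k) * ‖(V k).1‖ ^ 2
      ≤ τ ^ α * (2 * (b - a) ^ 2) * ‖g (((m + 1 : ℕ) - θ) * τ) + lapU0‖ ^ 2 := by
  obtain ⟨-, hmem, heq⟩ := hV
  set χ := (1 - θ) • V (m + 1) + θ • V m with hχdef
  have hχ : χ ∈ femSpace 𝒯 r :=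
    add_mem (Submodule.smul_mem _ _ (hmem _ hm)) (Submodule.smul_mem _ _ (hmem _ (by omega)))
  have hE := heq (m + 1) (by omega) hm χ hχ
  have hP := norm_fst_le_of_mem_H10 hab hχ.1
  have hχ2 : (1 - θ) • (V (m + 1)).2 + θ • (V (m + 1 - 1)).2 = χ.2 := rfl
  rw [hχ2, real_inner_self_eq_norm_sq] at hE
  set f := g (((m + 1 : ℕ) - θ) * τ) + lapU0
  have hf : inner ℝ f χ.1 ≤ ‖f‖ * (2 * (b - a) * ‖χ.2‖) :=
    (real_inner_le_norm _ _).trans (mul_le_mul_of_nonneg_left hP (norm_nonneg _))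
  have hsum0 : 0 ≤ ∑ k ∈ Finset.range (m + 2), weight α θ k := by
    refine le_trans ?_ (le_sum_weight hα0 hα1 hθ1 hc (m + 1))
    have : 0 ≤ 1 - (1 + (α / 2 - θ)) * α := by nlinarith
    have : 0 ≤ 1 - α := by linarith
    positivity
  have hlow := sum_mul_norm_sq_le_two_mul_sum_inner (w := weight α θ)
    (fun k hk => weight_nonpos hα0 hα1 hθ1 hc hk) hθ0 (by linarith)
    (mul_weight_zero_le hα0 hα1 hθ1) (fun k => (V k).1) m hsum0
  have hχ1 : (1 - θ) • (V (m + 1)).1 + θ • (V m).1 = χ.1 := rfl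
  simp only [hχ1] at hlow
  set S := ∑ k ∈ Finset.range (m + 2), weight α θ (m + 1 - k) * inner ℝ (V k).1 χ.1
  -- Young's inequality `2(b-a)‖f‖‖∇χ‖ ≤ (b-a)²‖f‖² + ‖∇χ‖²` cancels the gradient term exactly.
  have hS : τ ^ (-α) * S ≤ (b - a) ^ 2 * ‖f‖ ^ 2 := by
    nlinarith [sq_nonneg ((b - a) * ‖f‖ - ‖χ.2‖)]
  have hτα : 0 < τ ^ α := Real.rpow_pos_of_pos hτ α
  have hS' : S ≤ τ ^ α * ((b - a) ^ 2 * ‖f‖ ^ 2) := by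
    rwa [Real.rpow_neg hτ.le, inv_mul_le_iff₀ hτα] at hS
  linarith

lemma IsDiscreteSolution.norm_sq_le {a b α θ T : ℝ} {N : ℕ} {𝒯 : Mesh a b} {r : ℕ}
    {g : ℝ → L2 a b} {lapU0 : L2 a b} {V : ℕ → L2 a b × L2 a b}
    (hV : IsDiscreteSolution α θ (T / N) N 𝒯 r g lapU0 V) (hα0 : 0 < α) (hα1 : α < 1)
    (hc : (1 + (α / 2 - θ)) * (1 + α) ≤ 2) (hθ0 : 0 ≤ θ) (hθ1 : θ ≤ α / 2) (hab : a < b)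
    (hT : 0 < T) {m : ℕ} (hm : m + 1 ≤ N) (hmax : ∀ k ≤ m + 1, ‖(V k).1‖ ≤ ‖(V (m + 1)).1‖) :
    (1 - α) * (1 - (1 + (α / 2 - θ)) * α) * ‖(V (m + 1)).1‖ ^ 2
      ≤ T ^ α * (2 * (b - a) ^ 2) * ‖g (((m + 1 : ℕ) - θ) * (T / N)) + lapU0‖ ^ 2 := by
  have hN : (0 : ℝ) < N := by exact_mod_cast (by omega : 0 < N)
  have hτ : 0 < T / N := by positivity
  have h1 := hV.sum_weight_mul_norm_sq_le hα0 hα1 hc hθ0 hθ1 hab hτ hm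
  have h2 := mul_sum_le_sum_mul_of_forall_le (w := weight α θ) (y := fun k => ‖(V k).1‖ ^ 2)
    (fun k hk => weight_nonpos hα0 hα1 hθ1 hc hk) (by simp [hV.1]) m
    (fun k hk => by have := hmax k hk; gcongr)
  have h3 := mul_le_mul_of_nonneg_left (le_sum_weight hα0 hα1 hθ1 hc m)
    (sq_nonneg ‖(V (m + 1)).1‖)
  have hm0 : (0 : ℝ) < (m : ℝ) + 1 := by positivity
  have hmα : 0 < ((m : ℝ) + 1) ^ α := Real.rpow_pos_of_pos hm0 α
  -- The decay of the partial sums pairs with `τ^α` to form `t_{m+1}^α ≤ T^α`; this makes the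
  -- constant independent of `τ`.
  have hT' : ((m : ℝ) + 1) ^ α * (T / N) ^ α ≤ T ^ α := by
    rw [← Real.mul_rpow hm0.le hτ.le]
    refine Real.rpow_le_rpow (by positivity) ?_ hα0.le
    have : (m : ℝ) + 1 ≤ N := by exact_mod_cast hm
    rw [← mul_div_assoc, div_le_iff₀ hN, mul_comm]
    gcongr
  have h4 := mul_le_mul_of_nonneg_left (h3.trans (h2.trans h1)) hmα.le
  rw [Real.rpow_neg hm0.le] at h4
  calc (1 - α) * (1 - (1 + (α / 2 - θ)) * α) * ‖(V (m + 1)).1‖ ^ 2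
      = ((m : ℝ) + 1) ^ α * (‖(V (m + 1)).1‖ ^ 2 *
        ((1 - α) * (1 - (1 + (α / 2 - θ)) * α) * (((m : ℝ) + 1) ^ α)⁻¹)) := by
        field_simp
    _ ≤ _ := h4
    _ = (((m : ℝ) + 1) ^ α * (T / N) ^ α) *
        ((2 * (b - a) ^ 2) * ‖g (((m + 1 : ℕ) - θ) * (T / N)) + lapU0‖ ^ 2) := by ring
    _ ≤ T ^ α * ((2 * (b - a) ^ 2) * ‖g (((m + 1 : ℕ) - θ) * (T / N)) + lapU0‖ ^ 2) := by
        gcongr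
    _ = _ := by ring

theorem theorem5 (α θ T a b : ℝ) (hα0 : 0 < α) (hα1 : α < 1)
    (hθ0 : max 0 (α / 2 - (1 - α) / (1 + α)) ≤ θ) (hθ1 : θ ≤ α / 2)
    (hT : 0 < T) (hab : a < b) :
    ∃ C : ℝ, 0 < C ∧
      ∀ (N : ℕ) (_hN : 1 ≤ N) (𝒯 : Mesh a b) (r : ℕ) (_hr : 1 ≤ r)
        (g : ℝ → L2 a b) (u0 lapU0 : L2 a b) (_hu0 : IsWeakLaplacian a b u0 lapU0)
        (u0h : L2 a b) (V : ℕ → L2 a b × L2 a b)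
        (_hV : IsDiscreteSolution α θ (T / N) N 𝒯 r g lapU0 V)
        (U : ℕ → L2 a b) (_hU : ∀ n, U n = (V n).1 + u0h)
        (n : ℕ) (hn : 1 ≤ n) (_hnN : n ≤ N),
        ‖U n‖ ≤ ‖u0h‖ + C * ‖lapU0‖
          + C * (Finset.Icc 1 n).sup' (Finset.nonempty_Icc.mpr hn)
              (fun j : ℕ => ‖g (((j : ℝ) - θ) * (T / N))‖) := by
  have hθ : 0 ≤ θ := (le_max_left _ _).trans hθ0
  have hc : (1 + (α / 2 - θ)) * (1 + α) ≤ 2 := by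
    have h := (le_max_right _ _).trans hθ0
    have h' : α / 2 - θ ≤ (1 - α) / (1 + α) := by linarith
    rw [le_div_iff₀ (by linarith)] at h'
    linarith
  -- Strict because `(1+d)α ≤ 2α/(1+α) < 1`.
  have hd : 0 < (1 - α) * (1 - (1 + (α / 2 - θ)) * α) :=
    mul_pos (by linarith) (by nlinarith)
  have hTα : 0 < T ^ α := Real.rpow_pos_of_pos hT α
  have hL : 0 < b - a := by linarith
  set K := T ^ α * (2 * (b - a) ^ 2) / ((1 - α) * (1 - (1 + (α / 2 - θ)) * α)) with hK
  have hK0 : 0 < K := by positivity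
  refine ⟨√K, Real.sqrt_pos.mpr hK0, ?_⟩
  intro N _ 𝒯 r _ g u0 lapU0 _ u0h V hV U hU n hn hnN
  set F := (Finset.Icc 1 n).sup' (Finset.nonempty_Icc.mpr hn)
    (fun j : ℕ => ‖g (((j : ℝ) - θ) * (T / N))‖) with hF
  obtain ⟨m, hm, hmax⟩ := Finset.exists_max_image (Finset.Icc 1 n) (fun k => ‖(V k).1‖)
    (Finset.nonempty_Icc.mpr hn)
  obtain ⟨hm1, hmn⟩ := Finset.mem_Icc.mp hm
  obtain ⟨m, rfl⟩ : ∃ l, m = l + 1 := ⟨m - 1, by omega⟩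
  have hbound := hV.norm_sq_le hα0 hα1 hc hθ hθ1 hab hT (hmn.trans hnN) fun k hk => by
    rcases Nat.eq_zero_or_pos k with rfl | hk0
    · simp [hV.1]
    · exact hmax k (Finset.mem_Icc.mpr ⟨hk0, hk.trans hmn⟩)
  have hgF : ‖g (((m + 1 : ℕ) - θ) * (T / N))‖ ≤ F :=
    Finset.le_sup' (fun j : ℕ => ‖g (((j : ℝ) - θ) * (T / N))‖) hm
  have hVm : ‖(V (m + 1)).1‖ ≤ √K * (‖lapU0‖ + F) := by
    have h1 : ‖(V (m + 1)).1‖ ≤ √K * ‖g (((m + 1 : ℕ) - θ) * (T / N)) + lapU0‖ := by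
      refine (sq_le_sq₀ (norm_nonneg _) (by positivity)).mp ?_
      rw [mul_pow, Real.sq_sqrt hK0.le, hK, div_mul_eq_mul_div, le_div_iff₀ hd, mul_comm]
      exact hbound
    refine h1.trans (mul_le_mul_of_nonneg_left ?_ (Real.sqrt_nonneg _))
    have := norm_add_le (g (((m + 1 : ℕ) - θ) * (T / N))) lapU0
    linarith
  have hVn : ‖(V n).1‖ ≤ ‖(V (m + 1)).1‖ := hmax n (Finset.mem_Icc.mpr ⟨hn, le_rfl⟩)
  have hUn : ‖U n‖ ≤ ‖(V n).1‖ + ‖u0h‖ := by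
    rw [hU n]
    exact norm_add_le _ _
  linarith
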